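/- A \emph{modal algebra} is a Boolean algebra $M$ with an operation $\square$ such that $\square 1=1$ and $\square(a\land b)=\square a\land\square b$; put $\square^+a:=\square a\land a$. It is a \emph{$\mathsf{K4}$-algebra} if $\square a\le\square\square a$ for all $a$, and a \emph{$\mathsf{K4.Grz}$-algebra} if moreover $\square(\square(a\to\square a)\to a)\le\square a$ for all $a$. A \emph{frontal Heyting algebra} is a Heyting algebra $H$ with an operation $\boxtimes$ such that $\boxtimes 1=1$, $\boxtimes(a\land b)=\boxtimes a\land\boxtimes b$, $a\le\boxtimes a$ and $\boxtimes a\le b\lor(b\to a)$ for all $a,b$. For a $\mathsf{K4}$-algebra $M$, let $\rho M$ be the frontal Heyting algebra whose underlying bounded lattice is the sublattice $\{a\in M:\square^+a=a\}$ of $M$, with $a\to b:=\square^+(\neg a\lor b)$ and $\boxtimes a:=\square a$. For a frontal Heyting algebra $H$, let $\sigma H$ be the modal algebra obtained from the free Boolean extension $B(H)$ of $H$ (the Boolean algebra that contains $H$ as a bounded sublattice and is generated by it) by setting $\square a:=\boxtimes Ia$, where $Ia:=\bigvee\{b\in H:b\le a\}$, which always exists and belongs to $H$. A $\mathsf{K4}$-algebra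 $M$ is \emph{skeletal} if $M\cong\sigma\rho M$. A \emph{universal class} is a class of algebras of the same signature closed under isomorphic copies, subalgebras and ultraproducts; $\mathrm{Uni}(\mathcal K)$ denotes the least universal class containing $\mathcal K$. For a class $\mathcal V$ of $\mathsf{K4}$-algebras put $\rho\mathcal V:=\{\rho M:M\in\mathcal V\}$, and for a class $\mathcal W$ of frontal Heyting algebras put $\sigma\mathcal W:=\mathrm{Uni}\{\sigma H:H\in\mathcal W\}$. \textbf{Theorem (Skeletal generation theorem).} Every universal class $\mathcal U$ of $\mathsf{K4.Grz}$-algebras is generated by its skeletal elements: $\mathcal U=\mathrm{Uni}\{M\in\mathcal U: M\text{ is skeletal}\}$, and $\mathcal U=\sigma\rho\mathcal U$. -/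

import Mathlib

universe u

/-! ### Modal algebras and frontal Heyting algebras -/

/-- A modal algebra: a Boolean algebra with an operation `□` that satisfies
`□1 = 1` and `□(a ∧ b) = □a ∧ □b`. -/
structure ModalAlg : Type (u + 1) where
  carrier : Type u
  [isBoolean : BooleanAlgebra carrier]
  box : carrier → carrier
  box_top : box ⊤ = ⊤
  box_inf : ∀ a b, box (a ⊓ b) = box a ⊓ box b

attribute [instance] ModalAlg.isBoolean

/-- A frontal Heyting algebra: a Heyting algebra with an operation `⊠` that satisfies
`⊠1 = 1`, `⊠(a ∧ b) = ⊠a ∧ ⊠b`, `a ≤ ⊠a` and `⊠a ≤ b ∨ (b → a)`. -/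
structure FrontalHeytingAlg : Type (u + 1) where
  carrier : Type u
  [isHeyting : HeytingAlgebra carrier]
  box : carrier → carrier
  box_top : box ⊤ = ⊤
  box_inf : ∀ a b, box (a ⊓ b) = box a ⊓ box b
  le_box : ∀ a, a ≤ box a
  box_le : ∀ a b, box a ≤ b ⊔ (b ⇨ a)

attribute [instance] FrontalHeytingAlg.isHeyting

namespace ModalAlg

/-- `□⁺a = □a ∧ a`. -/
def boxPlus (M : ModalAlg.{u}) (a : M.carrier) : M.carrier := M.box a ⊓ a

/-- `K4`-algebras: `□a ≤ □□a`. -/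
def IsK4 (M : ModalAlg.{u}) : Prop := ∀ a, M.box a ≤ M.box (M.box a)

/-- `K4.Grz`-algebras: `K4`-algebras with `□(□(a → □a) → a) ≤ □a`. -/
def IsK4Grz (M : ModalAlg.{u}) : Prop :=
  M.IsK4 ∧ ∀ a, M.box (M.box (a ⇨ M.box a) ⇨ a) ≤ M.box a

/-- Isomorphism of modal algebras: a bijection that preserves and reflects the order (hence
preserves all Boolean operations) and commutes with `□`. -/
def Iso (M N : ModalAlg.{u}) : Prop :=
  ∃ e : M.carrier ≃o N.carrier, ∀ a, e (M.box a) = N.box (e a)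

/-- The subalgebra of `M` whose universe is a Boolean subalgebra closed under `□`. -/
def sub (M : ModalAlg.{u}) (S : BooleanSubalgebra M.carrier)
    (hS : ∀ a ∈ S, M.box a ∈ S) : ModalAlg.{u} where
  carrier := S
  box a := ⟨M.box a.1, hS a.1 a.2⟩
  box_top := Subtype.ext M.box_top
  box_inf a b := Subtype.ext (M.box_inf a.1 b.1)

theorem box_mono (M : ModalAlg.{u}) {a b : M.carrier} (h : a ≤ b) : M.box a ≤ M.box b := by
  have h1 := M.box_inf a b
  rw [inf_eq_left.2 h] at h1
  exact inf_eq_left.1 h1.symm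

/-! ### Ultraproducts -/

section Ultraproduct

variable {I : Type u} (F : Ultrafilter I) (M : I → ModalAlg.{u})

/-- The Boolean algebra of families modulo equality on a set of the ultrafilter, with the
operations computed coordinatewise. -/
instance ultraBoolean :
    BooleanAlgebra ((F : Filter I).Product fun i => (M i).carrier) where
  sup := Quotient.map₂ (fun f g i => f i ⊔ g i) (by
    intro f f' hf g g' hg
    filter_upwards [hf, hg] with i h1 h2
    rw [h1, h2])
  inf := Quotient.map₂ (fun f g i => f i ⊓ g i) (by
    intro f f' hf g g' hg
    filter_upwards [hf, hg] with i h1 h2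
    rw [h1, h2])
  compl := Quotient.map (fun f i => (f i)ᶜ) (by
    intro f f' hf
    filter_upwards [hf] with i h1
    rw [h1])
  top := Quotient.mk _ fun _ => ⊤
  bot := Quotient.mk _ fun _ => ⊥
  le := fun a b => Quotient.liftOn₂ a b (fun f g => ∀ᶠ i in (F : Filter I), f i ≤ g i) (by
    intro f g f' g' hf hg
    apply propext
    constructor
    · intro h
      filter_upwards [h, hf, hg] with i h0 h1 h2
      rwa [← h1, ← h2]
    · intro h
      filter_upwards [h, hf, hg] with i h0 h1 h2
      rwa [h1, h2])
  le_refl := by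
    rintro ⟨f⟩
    exact Filter.Eventually.of_forall fun i => le_refl (f i)
  le_trans := by
    rintro ⟨f⟩ ⟨g⟩ ⟨h⟩ h1 h2
    exact (Filter.Eventually.and h1 h2).mono fun i hi => hi.1.trans hi.2
  le_antisymm := by
    rintro ⟨f⟩ ⟨g⟩ h1 h2
    exact Quotient.sound ((Filter.Eventually.and h1 h2).mono fun i hi => le_antisymm hi.1 hi.2)
  le_sup_left := by
    rintro ⟨f⟩ ⟨g⟩
    exact Filter.Eventually.of_forall fun i => le_sup_left (a := f i) (b := g i)
  le_sup_right := by
    rintro ⟨f⟩ ⟨g⟩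
    exact Filter.Eventually.of_forall fun i => le_sup_right (a := f i) (b := g i)
  sup_le := by
    rintro ⟨f⟩ ⟨g⟩ ⟨h⟩ h1 h2
    exact (Filter.Eventually.and h1 h2).mono fun i hi => sup_le hi.1 hi.2
  inf_le_left := by
    rintro ⟨f⟩ ⟨g⟩
    exact Filter.Eventually.of_forall fun i => inf_le_left (a := f i) (b := g i)
  inf_le_right := by
    rintro ⟨f⟩ ⟨g⟩
    exact Filter.Eventually.of_forall fun i => inf_le_right (a := f i) (b := g i)
  le_inf := by
    rintro ⟨f⟩ ⟨g⟩ ⟨h⟩ h1 h2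
    exact (Filter.Eventually.and h1 h2).mono fun i hi => le_inf hi.1 hi.2
  le_sup_inf := by
    rintro ⟨f⟩ ⟨g⟩ ⟨h⟩
    exact Filter.Eventually.of_forall fun i => le_sup_inf (x := f i) (y := g i) (z := h i)
  inf_compl_le_bot := by
    rintro ⟨f⟩
    exact Filter.Eventually.of_forall fun i => (inf_compl_eq_bot (a := f i)).le
  top_le_sup_compl := by
    rintro ⟨f⟩
    exact Filter.Eventually.of_forall fun i => (sup_compl_eq_top (x := f i)).ge
  le_top := by
    rintro ⟨f⟩
    exact Filter.Eventually.of_forall fun i => le_top (a := f i)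
  bot_le := by
    rintro ⟨f⟩
    exact Filter.Eventually.of_forall fun i => bot_le (a := f i)
  sdiff_eq := fun _ _ => rfl
  himp_eq := fun _ _ => rfl

/-- The ultraproduct of a family of modal algebras, with all operations coordinatewise. -/
def ultraproduct : ModalAlg.{u} where
  carrier := (F : Filter I).Product fun i => (M i).carrier
  box := Quotient.map (fun f i => (M i).box (f i)) (by
    intro f f' hf
    filter_upwards [hf] with i h1
    rw [h1])
  box_top := Quotient.sound (Filter.Eventually.of_forall fun i => (M i).box_top)
  box_inf := by
    rintro ⟨f⟩ ⟨g⟩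
    exact Quotient.sound (Filter.Eventually.of_forall fun i => (M i).box_inf (f i) (g i))

end Ultraproduct

/-! ### Universal classes -/

/-- A universal class of modal algebras: a class closed under isomorphic copies, subalgebras
and ultraproducts. -/
structure IsUniversalClass (U : Set ModalAlg.{u}) : Prop where
  iso_mem : ∀ {M N : ModalAlg.{u}}, M ∈ U → Iso M N → N ∈ U
  sub_mem : ∀ {M : ModalAlg.{u}}, M ∈ U → ∀ (S : BooleanSubalgebra M.carrier)
    (hS : ∀ a ∈ S, M.box a ∈ S), M.sub S hS ∈ U
  ultraproduct_mem : ∀ {I : Type u} (F : Ultrafilter I) (M : I → ModalAlg.{u}),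
    (∀ i, M i ∈ U) → ultraproduct F M ∈ U

/-- `Uni K`: the universal class generated by `K`, i.e. the least universal class of modal
algebras that contains `K`. -/
def Uni (K : Set ModalAlg.{u}) : Set ModalAlg.{u} :=
  ⋂₀ {U | IsUniversalClass U ∧ K ⊆ U}

theorem isUniversalClass_Uni (K : Set ModalAlg.{u}) : IsUniversalClass (Uni K) where
  iso_mem hM hMN U hU := hU.1.iso_mem (hM U hU) hMN
  sub_mem hM S hS U hU := hU.1.sub_mem (hM U hU) S hS
  ultraproduct_mem F M hM U hU := hU.1.ultraproduct_mem F M fun i => hM i U hU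

/-! ### The frontal Heyting algebra `ρM` of quasi-open elements -/

section Rho

variable (M : ModalAlg.{u})

/-- `O⁺(M)`: the quasi-open elements of `M`, i.e. those with `□⁺a = a`, ordered as in `M`. -/
def QuasiOpen : Type u := {a : M.carrier // M.boxPlus a = a}

variable {M}

theorem boxPlus_eq_iff {a : M.carrier} : M.boxPlus a = a ↔ a ≤ M.box a := inf_eq_right

theorem boxPlus_boxPlus (h : M.IsK4) (a : M.carrier) :
    M.boxPlus (M.boxPlus a) = M.boxPlus a := by
  rw [boxPlus_eq_iff]
  unfold boxPlus
  rw [M.box_inf]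
  exact le_inf (inf_le_left.trans (h a)) inf_le_left

theorem boxPlus_box (h : M.IsK4) (a : M.carrier) : M.boxPlus (M.box a) = M.box a :=
  boxPlus_eq_iff.2 (h a)

/-- The Heyting algebra of quasi-open elements of a `K4`-algebra: meet, join, top and bottom
are those of `M`, and `a → b = □⁺(¬a ∨ b)`. -/
@[reducible] def quasiOpenHeyting (h : M.IsK4) : HeytingAlgebra M.QuasiOpen where
  le a b := a.1 ≤ b.1
  le_refl a := le_refl a.1
  le_trans _ _ _ h1 h2 := le_trans h1 h2
  le_antisymm _ _ h1 h2 := Subtype.ext (le_antisymm h1 h2)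
  sup a b := ⟨a.1 ⊔ b.1, boxPlus_eq_iff.2 (sup_le
    ((boxPlus_eq_iff.1 a.2).trans (M.box_mono le_sup_left))
    ((boxPlus_eq_iff.1 b.2).trans (M.box_mono le_sup_right)))⟩
  inf a b := ⟨a.1 ⊓ b.1, boxPlus_eq_iff.2 (by
    rw [M.box_inf]
    exact inf_le_inf (boxPlus_eq_iff.1 a.2) (boxPlus_eq_iff.1 b.2))⟩
  top := ⟨⊤, boxPlus_eq_iff.2 M.box_top.ge⟩
  bot := ⟨⊥, boxPlus_eq_iff.2 bot_le⟩
  himp a b := ⟨M.boxPlus (a.1ᶜ ⊔ b.1), boxPlus_boxPlus h _⟩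
  compl a := ⟨M.boxPlus (a.1ᶜ ⊔ ⊥), boxPlus_boxPlus h _⟩
  le_sup_left a b := le_sup_left (a := a.1) (b := b.1)
  le_sup_right a b := le_sup_right (a := a.1) (b := b.1)
  sup_le _ _ _ h1 h2 := sup_le h1 h2
  inf_le_left a b := inf_le_left (a := a.1) (b := b.1)
  inf_le_right a b := inf_le_right (a := a.1) (b := b.1)
  le_inf _ _ _ h1 h2 := le_inf h1 h2
  le_top a := le_top (a := a.1)
  bot_le a := bot_le (a := a.1)
  le_himp_iff a b c := by
    change a.1 ≤ M.boxPlus (b.1ᶜ ⊔ c.1) ↔ a.1 ⊓ b.1 ≤ c.1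
    have key : a.1 ≤ b.1ᶜ ⊔ c.1 ↔ a.1 ⊓ b.1 ≤ c.1 := by
      rw [sup_comm, ← himp_eq, le_himp_iff]
    rw [← key]
    exact ⟨fun h1 => h1.trans inf_le_right, fun h1 =>
      le_inf ((boxPlus_eq_iff.1 a.2).trans (M.box_mono h1)) h1⟩
  himp_bot _ := rfl

/-- `ρM`: the quasi-open elements of a `K4`-algebra `M` with `⊠a = □a`. -/
def rho (M : ModalAlg.{u}) (h : M.IsK4) : FrontalHeytingAlg.{u} :=
  letI : HeytingAlgebra M.QuasiOpen := quasiOpenHeyting h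
  { carrier := M.QuasiOpen
    box := fun a => ⟨M.box a.1, boxPlus_box h a.1⟩
    box_top := Subtype.ext M.box_top
    box_inf := fun a b => Subtype.ext (M.box_inf a.1 b.1)
    le_box := fun a => boxPlus_eq_iff.1 a.2
    box_le := by
      intro a b
      change M.box a.1 ≤ b.1 ⊔ M.boxPlus (b.1ᶜ ⊔ a.1)
      unfold boxPlus
      rw [sup_inf_left, ← sup_assoc, sup_compl_eq_top, top_sup_eq, inf_top_eq]
      exact (M.box_mono le_sup_right).trans le_sup_right }

end Rho

end ModalAlg

/-! ### The free Boolean extension of a Heyting algebra, and `σH` -/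

section FreeBoolean

variable {H : Type u} [HeytingAlgebra H]

/-- The Stone map. A prime filter of `H` is given by its characteristic function, a bounded
lattice homomorphism from `H` to the two-element lattice `Prop`; an element `a` is sent to the
set of all prime filters that contain it. -/
def stoneMap : BoundedLatticeHom H (Set (BoundedLatticeHom H Prop)) where
  toFun a := {x | x a}
  map_sup' a b := by ext x; simp
  map_inf' a b := by ext x; simp
  map_top' := by ext x; simp
  map_bot' := by ext x; simp

theorem stoneMap_le_iff {a b : H} : stoneMap a ≤ stoneMap b ↔ a ≤ b := by
  refine ⟨fun h => ?_, fun h => OrderHomClass.mono stoneMap h⟩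
  by_contra hab
  have hd : Disjoint (Order.PFilter.principal a : Set H) (Order.Ideal.principal b : Set H) := by
    rw [Set.disjoint_left]
    intro x hx hx'
    exact hab (le_trans (Order.PFilter.mem_principal.1 hx) (Order.Ideal.mem_principal.1 hx'))
  obtain ⟨J, hJ, hbJ, haJ⟩ := DistribLattice.prime_ideal_of_disjoint_filter_ideal hd
  let x : BoundedLatticeHom H Prop :=
    { toFun := fun c => c ∉ J
      map_sup' := fun c d => propext (by
        rw [Order.Ideal.sup_mem_iff, not_and_or]
        rfl)
      map_inf' := fun c d => propext (by
        constructor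
        · exact fun h1 => ⟨fun hc => h1 (J.lower inf_le_left hc),
            fun hd => h1 (J.lower inf_le_right hd)⟩
        · rintro ⟨hc, hd⟩ h1
          exact (hJ.mem_or_mem h1).elim hc hd)
      map_top' := propext ⟨fun _ => trivial, fun _ => hJ.toIsProper.top_notMem⟩
      map_bot' := propext ⟨fun h1 => h1 J.bot_mem, fun h1 => h1.elim⟩ }
  have hxa : x ∈ stoneMap a := fun h1 =>
    Set.disjoint_left.1 haJ (Order.PFilter.mem_principal.2 le_rfl) h1
  exact h hxa (hbJ (Order.Ideal.mem_principal.2 le_rfl))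

variable (H) in
/-- The free Boolean extension `B(H)`: the Boolean algebra generated by the image of `H` under
the Stone map. -/
def freeBoolean : BooleanSubalgebra (Set (BoundedLatticeHom H Prop)) :=
  BooleanSubalgebra.closure (Set.range (stoneMap (H := H)))

/-- The embedding of `H` into `B(H)`. -/
def freeBooleanOf : BoundedLatticeHom H (freeBoolean H) where
  toFun a := ⟨stoneMap a, BooleanSubalgebra.subset_closure ⟨a, rfl⟩⟩
  map_sup' a b := Subtype.ext (map_sup stoneMap a b)
  map_inf' a b := Subtype.ext (map_inf stoneMap a b)
  map_top' := Subtype.ext (map_top stoneMap)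
  map_bot' := Subtype.ext (map_bot stoneMap)

theorem freeBooleanOf_le_iff {a b : H} : freeBooleanOf a ≤ freeBooleanOf b ↔ a ≤ b :=
  stoneMap_le_iff

/-- The image of `H` generates `B(H)` as a Boolean algebra. -/
theorem closure_range_freeBooleanOf :
    BooleanSubalgebra.closure (Set.range (freeBooleanOf (H := H))) = ⊤ := by
  refine top_le_iff.1 fun a _ => BooleanSubalgebra.mem_closure.2 fun L hL => ?_
  have h : freeBoolean H ≤ L.map (freeBoolean H).subtype := by
    refine BooleanSubalgebra.closure_le.2 ?_
    rintro _ ⟨c, rfl⟩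
    exact ⟨freeBooleanOf c, hL ⟨c, rfl⟩, rfl⟩
  obtain ⟨b, hb, hba⟩ := h a.2
  rwa [← (Subtype.ext hba : b = a)]

/-- Below every `a ∈ B(H)` there is a greatest element of `H`. -/
theorem exists_isGreatest_le (a : freeBoolean H) :
    ∃ h : H, IsGreatest {b : H | freeBooleanOf b ≤ a} h := by
  suffices hs : ∀ x ∈ freeBoolean H, ∃ h : H, ∀ b : H, b ≤ h ↔ stoneMap b ≤ xᶜ by
    obtain ⟨h, hh⟩ := hs (a : Set _)ᶜ (BooleanSubalgebra.compl_mem a.2)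
    rw [compl_compl] at hh
    exact ⟨h, (hh h).1 le_rfl, fun b hb => (hh b).2 hb⟩
  intro x hx
  have hsub : IsSublattice (Set.range (stoneMap (H := H))) := by
    constructor
    · rintro _ ⟨c, rfl⟩ _ ⟨d, rfl⟩
      exact ⟨c ⊔ d, map_sup stoneMap c d⟩
    · rintro _ ⟨c, rfl⟩ _ ⟨d, rfl⟩
      exact ⟨c ⊓ d, map_inf stoneMap c d⟩
  refine BooleanSubalgebra.closure_sdiff_sup_induction
    (p := fun x _ => ∃ h : H, ∀ b : H, b ≤ h ↔ stoneMap b ≤ xᶜ)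
    hsub ⟨⊥, map_bot stoneMap⟩ ⟨⊤, map_top stoneMap⟩ ?_ ?_ x hx
  · rintro _ ⟨c, rfl⟩ _ ⟨d, rfl⟩
    refine ⟨c ⇨ d, fun b => ?_⟩
    rw [le_himp_iff, ← stoneMap_le_iff, map_inf, ← le_himp_iff, compl_sdiff]
  · rintro x _ y _ ⟨h1, hh1⟩ ⟨h2, hh2⟩
    refine ⟨h1 ⊓ h2, fun b => ?_⟩
    rw [le_inf_iff, hh1, hh2, compl_sup, le_inf_iff]

/-- `Ia = ⋁ {b ∈ H : b ≤ a}`, as an element of `H`. -/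
noncomputable def freeBooleanInterior (a : freeBoolean H) : H :=
  (exists_isGreatest_le a).choose

theorem freeBooleanInterior_isGreatest (a : freeBoolean H) :
    IsGreatest {b : H | freeBooleanOf b ≤ a} (freeBooleanInterior a) :=
  (exists_isGreatest_le a).choose_spec

theorem le_freeBooleanInterior_iff {b : H} {a : freeBoolean H} :
    b ≤ freeBooleanInterior a ↔ freeBooleanOf b ≤ a :=
  ⟨fun h => (freeBooleanOf_le_iff.2 h).trans (freeBooleanInterior_isGreatest a).1,
    fun h => (freeBooleanInterior_isGreatest a).2 h⟩

end FreeBoolean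

/-- `σH`: the free Boolean extension of `H` with `□a = ⊠Ia`. -/
noncomputable def FrontalHeytingAlg.sigma (H : FrontalHeytingAlg.{u}) : ModalAlg.{u} where
  carrier := freeBoolean H.carrier
  box a := freeBooleanOf (H.box (freeBooleanInterior a))
  box_top := by
    have h : freeBooleanInterior (⊤ : freeBoolean H.carrier) = ⊤ :=
      top_le_iff.1 (le_freeBooleanInterior_iff.2 le_top)
    rw [h, H.box_top, map_top]
  box_inf a b := by
    have h : freeBooleanInterior (a ⊓ b) = freeBooleanInterior a ⊓ freeBooleanInterior b :=
      eq_of_forall_le_iff fun c => by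
        rw [le_inf_iff, le_freeBooleanInterior_iff, le_freeBooleanInterior_iff,
          le_freeBooleanInterior_iff, le_inf_iff]
    rw [h, H.box_inf, map_inf]

/-! ### Skeletal algebras and the action of `ρ` and `σ` on classes -/

/-- A `K4`-algebra `M` is skeletal when it is isomorphic to `σρM`. -/
def ModalAlg.IsSkeletal (M : ModalAlg.{u}) : Prop :=
  ∃ h : M.IsK4, M.Iso (M.rho h).sigma

/-- `ρV = {ρM : M ∈ V}`, for a class `V` of `K4`-algebras. -/
def rhoClass (V : Set ModalAlg.{u}) : Set FrontalHeytingAlg.{u} :=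
  {H | ∃ M ∈ V, ∃ h : M.IsK4, H = M.rho h}

/-- `σU = Uni {σH : H ∈ U}`, for a class `U` of frontal Heyting algebras. -/
def sigmaClass (U : Set FrontalHeytingAlg.{u}) : Set ModalAlg.{u} :=
  ModalAlg.Uni {M | ∃ H ∈ U, M = H.sigma}

/-! The quasi-open elements of a `K4`-algebra `M` generate a Boolean subalgebra containing every
`□a`, hence a modal subalgebra, `skeleton`. A Boolean algebra generated by a bounded sublattice is
determined by that sublattice, and `□x = □(□⁺x)` with `□⁺x` the greatest quasi-open element below
`x`; so the skeleton is skeletal and isomorphic to `σρM`. A universal class contains the skeletons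
of its members, so both equalities reduce to `mem_of_skeleton_mem`: a `K4.Grz`-algebra embeds into
an ultrapower of its skeleton.

By finite approximation this follows from `exists_local_embedding`. Cut `⊤` into finitely many cells
`p` deciding the given elements `a` and all `□a`, `□⁺a`. Each cell contains its passive part, a
nonzero element of the skeleton; by Grz, a point that sees `p` sees the passive part of `p`. Enlarge
the passive parts to a partition `q p` inside the skeleton that respects all `□a` and `□⁺a`, and
send `a` to the join of the `q p` with `p ≤ a`. The passive parts give `□(g a) ≤ □a`, the fixed
elements `□⁺a` give the converse. -/

/-! ### Uniqueness of the free Boolean extension. -/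

section FreeBooleanUnique

variable {L B C : Type*} [Lattice L] [BoundedOrder L] [BooleanAlgebra B] [BooleanAlgebra C]

/-- In the Boolean subalgebra of `B × C` generated by the graph of the correspondence
`f a ↦ g a` between two lattice embeddings, the two coordinates vanish simultaneously. -/
theorem fst_eq_bot_iff_snd_eq_bot {f : BoundedLatticeHom L B} {g : BoundedLatticeHom L C}
    (hf : ∀ a b, f a ≤ f b ↔ a ≤ b) (hg : ∀ a b, g a ≤ g b ↔ a ≤ b) {z : B × C}
    (hz : z ∈ BooleanSubalgebra.closure (Set.range fun a => (f a, g a))) :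
    z.1 = ⊥ ↔ z.2 = ⊥ := by
  have hsub : IsSublattice (Set.range fun a => (f a, g a)) := by
    constructor
    · rintro _ ⟨c, rfl⟩ _ ⟨d, rfl⟩
      exact ⟨c ⊔ d, by simp⟩
    · rintro _ ⟨c, rfl⟩ _ ⟨d, rfl⟩
      exact ⟨c ⊓ d, by simp⟩
  -- Over a bounded sublattice every generated element is a finite join of differences, and the
  -- difference of the images of `c` and `d` vanishes, in either coordinate, exactly when `c ≤ d`.
  refine BooleanSubalgebra.closure_sdiff_sup_induction
    (p := fun z _ => z.1 = ⊥ ↔ z.2 = ⊥) hsub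
    ⟨⊥, Prod.ext (map_bot f) (map_bot g)⟩ ⟨⊤, Prod.ext (map_top f) (map_top g)⟩ ?_ ?_ z hz
  · rintro _ ⟨c, rfl⟩ _ ⟨d, rfl⟩
    simp [sdiff_eq_bot_iff, hf, hg]
  · rintro x _ y _ h1 h2
    simp [sup_eq_bot_iff, h1, h2]

/-- Two Boolean algebras generated by isomorphic bounded sublattices are isomorphic. -/
theorem exists_orderIso_of_closure_range_eq_top (f : BoundedLatticeHom L B)
    (g : BoundedLatticeHom L C)
    (hf : ∀ a b, f a ≤ f b ↔ a ≤ b) (hg : ∀ a b, g a ≤ g b ↔ a ≤ b)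
    (hf' : BooleanSubalgebra.closure (Set.range f) = ⊤)
    (hg' : BooleanSubalgebra.closure (Set.range g) = ⊤) :
    ∃ e : B ≃o C, ∀ a, e (f a) = g a := by
  -- `G` turns out to be the graph of the isomorphism: `hle` makes it single-valued and
  -- order-preserving both ways, `h1` and `h2` make it total and onto.
  set G := BooleanSubalgebra.closure (Set.range fun a => (f a, g a)) with hG
  have hmem (a : L) : (f a, g a) ∈ G := BooleanSubalgebra.subset_closure ⟨a, rfl⟩
  have hle {z w : B × C} (hz : z ∈ G) (hw : w ∈ G) : z.1 ≤ w.1 ↔ z.2 ≤ w.2 := by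
    rw [← sdiff_eq_bot_iff, ← sdiff_eq_bot_iff]
    exact fst_eq_bot_iff_snd_eq_bot hf hg (BooleanSubalgebra.sdiff_mem hz hw)
  have h1 (x : B) : ∃ y, (x, y) ∈ G := by
    have hx : x ∈ BooleanSubalgebra.closure (Set.range f) := hf' ▸ BooleanSubalgebra.mem_top
    induction hx using BooleanSubalgebra.closure_bot_sup_induction with
    | mem x hx => obtain ⟨a, rfl⟩ := hx; exact ⟨g a, hmem a⟩
    | bot => exact ⟨⊥, BooleanSubalgebra.bot_mem⟩
    | sup x _ y _ h1 h2 =>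
      obtain ⟨z, hz⟩ := h1
      obtain ⟨w, hw⟩ := h2
      exact ⟨z ⊔ w, BooleanSubalgebra.sup_mem hz hw⟩
    | compl x _ h =>
      obtain ⟨z, hz⟩ := h
      exact ⟨zᶜ, BooleanSubalgebra.compl_mem hz⟩
  have h2 (y : C) : ∃ x, (x, y) ∈ G := by
    have hy : y ∈ BooleanSubalgebra.closure (Set.range g) := hg' ▸ BooleanSubalgebra.mem_top
    induction hy using BooleanSubalgebra.closure_bot_sup_induction with
    | mem x hx => obtain ⟨a, rfl⟩ := hx; exact ⟨f a, hmem a⟩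
    | bot => exact ⟨⊥, BooleanSubalgebra.bot_mem⟩
    | sup x _ y _ h1 h2 =>
      obtain ⟨z, hz⟩ := h1
      obtain ⟨w, hw⟩ := h2
      exact ⟨z ⊔ w, BooleanSubalgebra.sup_mem hz hw⟩
    | compl x _ h =>
      obtain ⟨z, hz⟩ := h
      exact ⟨zᶜ, BooleanSubalgebra.compl_mem hz⟩
  choose u hu using h1
  choose v hv using h2
  refine ⟨⟨⟨u, v, fun x => ?_, fun y => ?_⟩, fun {x y} => (hle (hu x) (hu y)).symm⟩, fun a => ?_⟩
  · exact le_antisymm ((hle (hv _) (hu _)).2 le_rfl) ((hle (hu _) (hv _)).2 le_rfl)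
  · exact le_antisymm ((hle (hu _) (hv _)).1 le_rfl) ((hle (hv _) (hu _)).1 le_rfl)
  · exact le_antisymm ((hle (hu _) (hmem a)).1 le_rfl) ((hle (hmem a) (hu _)).1 le_rfl)

end FreeBooleanUnique

/-! ### The skeleton and its identification with `σρM`. -/

namespace ModalAlg

theorem Iso.symm {M N : ModalAlg.{u}} (h : Iso M N) : Iso N M := by
  obtain ⟨e, he⟩ := h
  exact ⟨e.symm, fun a => by rw [e.symm_apply_eq, he, e.apply_symm_apply]⟩

/-- A modal algebra generated by a sublattice isomorphic to `H`, in which `□x` is `⊠` of the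
greatest element of `H` below `x`, is isomorphic to `σH`. -/
theorem iso_sigma (N : ModalAlg.{u}) (H : FrontalHeytingAlg.{u})
    (f : BoundedLatticeHom H.carrier N.carrier) (hf : ∀ a b, f a ≤ f b ↔ a ≤ b)
    (hgen : BooleanSubalgebra.closure (Set.range f) = ⊤)
    (hbox : ∀ x, ∃ y, (∀ b, b ≤ y ↔ f b ≤ x) ∧ N.box x = f (H.box y)) :
    Iso N H.sigma := by
  obtain ⟨e, he⟩ := exists_orderIso_of_closure_range_eq_top f (freeBooleanOf (H := H.carrier)) hf
    (fun _ _ => freeBooleanOf_le_iff) hgen closure_range_freeBooleanOf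
  refine ⟨e, fun x => ?_⟩
  obtain ⟨y, hy, hxy⟩ := hbox x
  have hI : freeBooleanInterior (e x) = y := eq_of_forall_le_iff fun b => by
    rw [le_freeBooleanInterior_iff, hy, ← he, e.le_iff_le]
  exact (congrArg e hxy).trans ((he _).trans (hI ▸ rfl))

variable {M : ModalAlg.{u}}

/-- The Boolean subalgebra of `M` generated by the quasi-open elements. -/
def openGenerated (M : ModalAlg.{u}) : BooleanSubalgebra M.carrier :=
  BooleanSubalgebra.closure {a | M.boxPlus a = a}

theorem mem_openGenerated {a : M.carrier} (h : a ≤ M.box a) : a ∈ M.openGenerated :=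
  BooleanSubalgebra.subset_closure (boxPlus_eq_iff.2 h)

theorem box_mem_openGenerated (h : M.IsK4) (a : M.carrier) : M.box a ∈ M.openGenerated :=
  mem_openGenerated (h a)

theorem box_boxPlus (h : M.IsK4) (a : M.carrier) : M.box (M.boxPlus a) = M.box a := by
  rw [boxPlus, box_inf]
  exact inf_eq_right.2 (h a)

/-- The modal subalgebra of a `K4`-algebra generated by the quasi-open elements. -/
def skeleton (M : ModalAlg.{u}) (h : M.IsK4) : ModalAlg.{u} :=
  M.sub M.openGenerated fun a _ => box_mem_openGenerated h a

theorem isK4_skeleton (h : M.IsK4) : (M.skeleton h).IsK4 := fun a => h a.1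

/-- This makes `□⁺` play the role of the interior `I` of the free Boolean extension. -/
theorem le_boxPlus_iff {a b : M.carrier} (ha : M.boxPlus a = a) :
    a ≤ M.boxPlus b ↔ a ≤ b :=
  ⟨fun h' => h'.trans inf_le_right, fun h' =>
    le_inf ((boxPlus_eq_iff.1 ha).trans (M.box_mono h')) h'⟩

theorem closure_quasiOpen_skeleton (h : M.IsK4) :
    BooleanSubalgebra.closure {a : (M.skeleton h).carrier | M.boxPlus a.1 = a.1} = ⊤ := by
  refine top_le_iff.1 fun a _ => BooleanSubalgebra.mem_closure.2 fun L hL => ?_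
  have h' : M.openGenerated ≤ L.map M.openGenerated.subtype :=
    BooleanSubalgebra.closure_le.2 fun c hc =>
      ⟨⟨c, BooleanSubalgebra.subset_closure hc⟩, hL hc, rfl⟩
  obtain ⟨b, hb, hba⟩ := h' a.2
  rwa [← (Subtype.ext hba : b = a)]

theorem skeleton_iso_sigma_rho (h : M.IsK4) : Iso (M.skeleton h) (M.rho h).sigma := by
  let f : BoundedLatticeHom (M.rho h).carrier (M.skeleton h).carrier :=
    { toFun := fun a => ⟨a.1, BooleanSubalgebra.subset_closure a.2⟩
      map_sup' := fun _ _ => rfl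
      map_inf' := fun _ _ => rfl
      map_top' := rfl
      map_bot' := rfl }
  refine iso_sigma _ _ f (fun _ _ => Iff.rfl) ?_ fun x => ?_
  · rw [← closure_quasiOpen_skeleton h]
    congr 1
    ext x
    exact ⟨by rintro ⟨a, rfl⟩; exact a.2, fun hx => ⟨⟨x.1, hx⟩, rfl⟩⟩
  · exact ⟨⟨M.boxPlus x.1, boxPlus_boxPlus h _⟩, fun b => le_boxPlus_iff b.2,
      Subtype.ext (box_boxPlus h x.1).symm⟩

/-- Being quasi-open means the same in the skeleton as in `M`, so the skeleton is generated by its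
own quasi-open elements. -/
theorem isSkeletal_skeleton (h : M.IsK4) : (M.skeleton h).IsSkeletal := by
  have h' := isK4_skeleton h
  refine ⟨h', ?_⟩
  let f : BoundedLatticeHom ((M.skeleton h).rho h').carrier (M.skeleton h).carrier :=
    { toFun := fun a => a.1
      map_sup' := fun _ _ => rfl
      map_inf' := fun _ _ => rfl
      map_top' := rfl
      map_bot' := rfl }
  refine iso_sigma _ _ f (fun _ _ => Iff.rfl) ?_ fun x => ?_
  · rw [← closure_quasiOpen_skeleton h]
    congr 1
    ext x
    exact ⟨by rintro ⟨a, rfl⟩; exact congrArg Subtype.val a.2,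
      fun hx => ⟨⟨x, Subtype.ext hx⟩, rfl⟩⟩
  · exact ⟨⟨(M.skeleton h).boxPlus x, boxPlus_boxPlus h' _⟩, fun b => le_boxPlus_iff (M := M.skeleton h) b.2,
      (box_boxPlus h' x).symm⟩

end ModalAlg

/-! ### Finite partitions of a Boolean algebra and their transfer. -/

theorem le_of_finset_sup_eq_top {B ι : Type*} [BooleanAlgebra B] {s : Finset ι} {f : ι → B}
    {a b : B} (h : s.sup f = ⊤) (h' : ∀ i ∈ s, a ⊓ f i ≤ b) : a ≤ b := by
  have h1 : a ⊓ s.sup f ≤ b := by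
    rw [Finset.sup_inf_distrib_left]
    exact Finset.sup_le h'
  rwa [h, inf_top_eq] at h1

theorem BooleanSubalgebra.finset_sup_mem {B ι : Type*} [BooleanAlgebra B]
    (L : BooleanSubalgebra B) {s : Finset ι} {f : ι → B} (h : ∀ i ∈ s, f i ∈ L) : s.sup f ∈ L :=
  Finset.sup_induction BooleanSubalgebra.bot_mem (fun _ h1 _ h2 => BooleanSubalgebra.sup_mem h1 h2) h

theorem BooleanSubalgebra.finset_inf_mem {B ι : Type*} [BooleanAlgebra B]
    (L : BooleanSubalgebra B) {s : Finset ι} {f : ι → B} (h : ∀ i ∈ s, f i ∈ L) : s.inf f ∈ L :=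
  Finset.inf_induction BooleanSubalgebra.top_mem (fun _ h1 _ h2 => BooleanSubalgebra.inf_mem h1 h2) h

/-- Every finite set of elements of a Boolean algebra is decided by a finite partition. -/
theorem exists_finpartition_decides {B : Type*} [BooleanAlgebra B] (S : Finset B) :
    ∃ P : Finpartition (⊤ : B), ∀ a ∈ S, ∀ p ∈ P.parts, p ≤ a ∨ p ≤ aᶜ := by
  classical
  induction S using Finset.induction_on with
  | empty => exact ⟨⊤, by simp⟩
  | insert b S _ ih =>
    obtain ⟨P, hP⟩ := ih
    -- One of `b`, `bᶜ` may be `⊥`, which cannot be a part and has to be erased.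
    let Q : Finpartition (⊤ : B) := Finpartition.ofErase {b, bᶜ}
      ((Finset.supIndep_iff_pairwiseDisjoint).2 (by
        rintro x hx y hy hxy
        simp only [Finset.coe_insert, Finset.coe_singleton, Set.mem_insert_iff,
          Set.mem_singleton_iff] at hx hy
        rcases hx with rfl | rfl <;> rcases hy with rfl | rfl
        · exact absurd rfl hxy
        · exact disjoint_compl_right
        · exact disjoint_compl_left
        · exact absurd rfl hxy))
      (by simp)
    refine ⟨P ⊓ Q, fun a ha p hp => ?_⟩
    rcases Finset.mem_insert.1 ha with rfl | ha
    · obtain ⟨q, hq, hpq⟩ := (inf_le_right : P ⊓ Q ≤ Q) hp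
      have hq' : q = a ∨ q = aᶜ := by
        have := Finset.mem_of_mem_erase hq
        simpa using this
      rcases hq' with rfl | rfl
      · exact Or.inl hpq
      · exact Or.inr hpq
    · obtain ⟨q, hq, hpq⟩ := (inf_le_left : P ⊓ Q ≤ P) hp
      exact (hP a ha q hq).imp hpq.trans hpq.trans

namespace Finpartition

variable {B : Type*} [BooleanAlgebra B] (P : Finpartition (⊤ : B)) (q : B → B)

open Classical in
/-- The map that sends an element decided by the partition `P` to the corresponding join of the
elements `q p`. -/
noncomputable def transfer (a : B) : B := (P.parts.filter (· ≤ a)).sup q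

variable {P q} {a b p : B}

theorem le_transfer (hp : p ∈ P.parts) (h : p ≤ a) : q p ≤ P.transfer q a := by
  classical
  exact Finset.le_sup (f := q) (Finset.mem_filter.2 ⟨hp, h⟩)

theorem transfer_le (h : ∀ p ∈ P.parts, p ≤ a → q p ≤ b) : P.transfer q a ≤ b := by
  classical
  exact Finset.sup_le fun p hp => h p (Finset.mem_filter.1 hp).1 (Finset.mem_filter.1 hp).2

theorem not_le_compl_of_le (hp : p ∈ P.parts) (h : p ≤ a) : ¬p ≤ aᶜ := fun h' =>
  P.ne_bot hp (le_bot_iff.1 ((le_inf h h').trans inf_compl_eq_bot.le))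

theorem transfer_compl (hq : (P.parts : Set B).PairwiseDisjoint q) (hq' : P.parts.sup q = ⊤)
    (ha : ∀ p ∈ P.parts, p ≤ a ∨ p ≤ aᶜ) : P.transfer q aᶜ = (P.transfer q a)ᶜ := by
  classical
  refine (IsCompl.of_le ?_ ?_).compl_eq.symm
  · rw [← disjoint_iff_inf_le]
    refine (Finset.disjoint_sup_left).2 fun x hx => (Finset.disjoint_sup_right).2 fun y hy => ?_
    obtain ⟨hx, hxa⟩ := Finset.mem_filter.1 hx
    obtain ⟨hy, hya⟩ := Finset.mem_filter.1 hy
    refine hq hx hy ?_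
    rintro rfl
    exact not_le_compl_of_le hx hxa hya
  · rw [← hq']
    refine Finset.sup_le fun p hp => ?_
    rcases ha p hp with h | h
    · exact (le_transfer hp h).trans le_sup_left
    · exact (le_transfer hp h).trans le_sup_right

/-- No decidedness is needed: a cell lies below a meet iff it lies below both factors, and distinct
cells contribute disjoint elements. -/
theorem transfer_inf (hq : (P.parts : Set B).PairwiseDisjoint q) :
    P.transfer q (a ⊓ b) = P.transfer q a ⊓ P.transfer q b := by
  classical
  refine le_antisymm (le_inf ?_ ?_) ?_
  · exact transfer_le fun p hp h => le_transfer hp (h.trans inf_le_left)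
  · exact transfer_le fun p hp h => le_transfer hp (h.trans inf_le_right)
  · unfold transfer
    rw [Finset.sup_inf_sup]
    refine Finset.sup_le fun x hx => ?_
    obtain ⟨h1, h2⟩ := Finset.mem_product.1 hx
    obtain ⟨h1, h1'⟩ := Finset.mem_filter.1 h1
    obtain ⟨h2, h2'⟩ := Finset.mem_filter.1 h2
    by_cases hx : x.1 = x.2
    · exact inf_le_left.trans (le_transfer h1 (le_inf h1' (hx ▸ h2')))
    · exact (hq h1 h2 hx).le_bot.trans bot_le

/-- A cell `p` below `a` and `bᶜ` would have `q p` below a join of elements disjoint from it,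
forcing `q p = ⊥`. -/
theorem le_of_transfer_le (hq : (P.parts : Set B).PairwiseDisjoint q)
    (hq0 : ∀ p ∈ P.parts, q p ≠ ⊥) (ha : ∀ p ∈ P.parts, p ≤ a ∨ p ≤ aᶜ)
    (hb : ∀ p ∈ P.parts, p ≤ b ∨ p ≤ bᶜ)
    (h : P.transfer q a ≤ P.transfer q b) : a ≤ b := by
  refine le_of_finset_sup_eq_top P.sup_parts fun p hp => ?_
  rcases ha p hp with hpa | hpa
  · refine inf_le_right.trans ?_
    obtain hpb | hpb := hb p hp
    · exact hpb
    · refine absurd ?_ (hq0 p hp)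
      have h1 : q p ≤ P.transfer q b := (le_transfer hp hpa).trans h
      have h2 : P.transfer q b ≤ (q p)ᶜ := transfer_le fun r hr hrb =>
        le_compl_iff_disjoint_right.2 (hq hr hp (by
          rintro rfl
          exact not_le_compl_of_le hr hrb hpb))
      exact le_bot_iff.1 ((le_inf le_rfl (h1.trans h2)).trans inf_compl_eq_bot.le)
  · exact ((inf_le_inf_left a hpa).trans inf_compl_eq_bot.le).trans bot_le

theorem transfer_mem {L : BooleanSubalgebra B} (h : ∀ p ∈ P.parts, q p ∈ L) :
    P.transfer q a ∈ L := by
  classical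
  exact L.finset_sup_mem fun p hp => h p (Finset.mem_filter.1 hp).1

end Finpartition

/-- Elements `r p` of a Boolean subalgebra `L` that lie below the parts of a finite partition can
be enlarged to a partition by elements of `L` without leaving the elements of a given finite
subset of `L`. -/
theorem Finpartition.exists_enlargement {B : Type*} [BooleanAlgebra B]
    (P : Finpartition (⊤ : B)) (L : BooleanSubalgebra B) (E : Finset B) (hE : ∀ e ∈ E, e ∈ L)
    (hPE : ∀ e ∈ E, ∀ p ∈ P.parts, p ≤ e ∨ p ≤ eᶜ) (r : B → B)
    (hr : ∀ p ∈ P.parts, r p ∈ L) (hrp : ∀ p ∈ P.parts, r p ≤ p) :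
    ∃ q : B → B, (P.parts : Set B).PairwiseDisjoint q ∧ P.parts.sup q = ⊤ ∧
      (∀ p ∈ P.parts, q p ∈ L) ∧ (∀ p ∈ P.parts, r p ≤ q p) ∧
      ∀ e ∈ E, ∀ p ∈ P.parts, (p ≤ e → q p ≤ e) ∧ (¬p ≤ e → q p ≤ eᶜ) := by
  classical
  let key (p : B) : Finset B := E.filter (p ≤ ·)
  have mem_key {p e : B} : e ∈ key p ↔ e ∈ E ∧ p ≤ e := Finset.mem_filter
  -- One chosen part for each class of parts lying below the same elements of `E`.
  let rep (p : B) : B := Function.invFunOn key P.parts (key p)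
  have rep_mem {p : B} (hp : p ∈ P.parts) : rep p ∈ P.parts := by
    have : rep p ∈ (P.parts : Set B) := Function.invFunOn_mem ⟨p, hp, rfl⟩
    exact this
  have key_rep {p : B} (hp : p ∈ P.parts) : key (rep p) = key p :=
    Function.invFunOn_eq ⟨p, hp, rfl⟩
  have rep_congr {p p' : B} (h : key p = key p') : rep p = rep p' :=
    congrArg (Function.invFunOn key P.parts) h
  -- The atom of the algebra generated by `E` that contains `p`, given only to the representative so
  -- that distinct parts get disjoint elements.
  let c (p : B) : B :=
    if rep p = p then (key p).inf id ⊓ ((E \ key p).sup id)ᶜ else ⊥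
  have c_rep {p : B} (h : rep p = p) : c p = (key p).inf id ⊓ ((E \ key p).sup id)ᶜ := if_pos h
  have c_not {p : B} (h : rep p ≠ p) : c p = ⊥ := if_neg h
  have c_le {p e : B} (he : e ∈ E) (h : p ≤ e) : c p ≤ e := by
    by_cases hp : rep p = p
    · rw [c_rep hp]
      exact inf_le_left.trans (Finset.inf_le (f := id) (mem_key.2 ⟨he, h⟩))
    · exact (c_not hp).le.trans bot_le
  have c_le_compl {p e : B} (he : e ∈ E) (h : ¬p ≤ e) : c p ≤ eᶜ := by
    by_cases hp : rep p = p
    · rw [c_rep hp]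
      refine inf_le_right.trans (compl_le_compl (Finset.le_sup (f := id) ?_))
      exact Finset.mem_sdiff.2 ⟨he, fun h' => h (mem_key.1 h').2⟩
    · exact (c_not hp).le.trans bot_le
  have c_disj {p p' : B} (h : p ≠ p') : Disjoint (c p) (c p') := by
    by_cases hp : rep p = p
    · by_cases hp' : rep p' = p'
      · have hk : key p ≠ key p' := fun hk => h (hp.symm.trans ((rep_congr hk).trans hp'))
        have : ∃ e ∈ E, ¬(p ≤ e ↔ p' ≤ e) := by
          by_contra! hcon
          exact hk (Finset.filter_congr hcon)
        obtain ⟨e, he, hne⟩ := this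
        by_cases h1 : p ≤ e
        · have h2 : ¬p' ≤ e := fun h2 => hne ⟨fun _ => h2, fun _ => h1⟩
          exact disjoint_compl_right.mono (c_le he h1) (c_le_compl he h2)
        · have h2 : p' ≤ e := by
            by_contra h2
            exact hne ⟨fun h => absurd h h1, fun h => absurd h h2⟩
          exact disjoint_compl_left.mono (c_le_compl he h1) (c_le he h2)
      · rw [c_not hp']; exact disjoint_bot_right
    · rw [c_not hp]; exact disjoint_bot_left
  have le_c {p : B} (hp : p ∈ P.parts) : p ≤ c (rep p) := by
    rw [c_rep (rep_congr (key_rep hp)), key_rep hp]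
    refine le_inf (Finset.le_inf fun e he => (mem_key.1 he).2) ?_
    rw [Finset.compl_sup]
    refine Finset.le_inf fun e he => ?_
    obtain ⟨he, he'⟩ := Finset.mem_sdiff.1 he
    exact (hPE e he p hp).resolve_left fun h => he' (mem_key.2 ⟨he, h⟩)
  have c_mem (p : B) : c p ∈ L := by
    by_cases hp : rep p = p
    · rw [c_rep hp]
      refine BooleanSubalgebra.inf_mem ?_ (BooleanSubalgebra.compl_mem ?_)
      · exact L.finset_inf_mem fun e he => hE e (mem_key.1 he).1
      · exact L.finset_sup_mem fun e he => hE e (Finset.mem_sdiff.1 he).1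
    · rw [c_not hp]; exact BooleanSubalgebra.bot_mem
  let R : B := P.parts.sup r
  have hR : R ∈ L := L.finset_sup_mem hr
  -- Whatever the `r p` leave uncovered in an atom goes to its representative.
  refine ⟨fun p => r p ⊔ c p \ R, ?_, ?_, ?_, fun p _ => le_sup_left, ?_⟩
  · intro p hp p' hp' hne
    have h1 : Disjoint (r p) (r p') := (P.disjoint hp hp' hne).mono (hrp p hp) (hrp p' hp')
    have h2 : Disjoint (r p) (c p' \ R) :=
      disjoint_sdiff_self_right.mono_left (Finset.le_sup (f := r) hp)
    have h3 : Disjoint (c p \ R) (r p') :=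
      disjoint_sdiff_self_left.mono_right (Finset.le_sup (f := r) hp')
    have h4 : Disjoint (c p \ R) (c p' \ R) := (c_disj hne).mono sdiff_le sdiff_le
    exact Disjoint.sup_left (Disjoint.sup_right h1 h2) (Disjoint.sup_right h3 h4)
  · refine top_le_iff.1 (le_of_finset_sup_eq_top P.sup_parts fun p hp => ?_)
    refine (inf_le_right.trans (le_c hp)).trans ?_
    refine le_sup_sdiff.trans (sup_le (Finset.sup_mono_fun fun p' _ => le_sup_left) ?_)
    exact le_sup_right.trans (Finset.le_sup (f := fun p => r p ⊔ c p \ R) (rep_mem hp))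
  · exact fun p hp => BooleanSubalgebra.sup_mem (hr p hp)
      (BooleanSubalgebra.sdiff_mem (c_mem p) hR)
  · exact fun e he p hp => ⟨fun h => sup_le ((hrp p hp).trans h) (sdiff_le.trans (c_le he h)),
      fun h => sup_le ((hrp p hp).trans ((hPE e he p hp).resolve_left h))
        (sdiff_le.trans (c_le_compl he h))⟩

/-! ### Passive parts and local embeddings. -/

namespace ModalAlg

variable {M : ModalAlg.{u}}

/-- The part of `p` that consists of the points which never return to `p` after leaving it. -/
def passive (M : ModalAlg.{u}) (p : M.carrier) : M.carrier :=
  p ⊓ M.box (pᶜ ⇨ M.box pᶜ)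

theorem passive_le (p : M.carrier) : M.passive p ≤ p := inf_le_left

/-- The passive part is a difference of two quasi-open elements, `v` and `pᶜ ⊓ v`; the latter is
quasi-open because `v ≤ pᶜ ⇨ □pᶜ`. -/
theorem passive_mem_openGenerated (h : M.IsK4) (p : M.carrier) :
    M.passive p ∈ M.openGenerated := by
  set v := M.boxPlus (pᶜ ⇨ M.box pᶜ) with hv
  have hvo : v ≤ M.box v := boxPlus_eq_iff.1 (boxPlus_boxPlus h _)
  have hw : pᶜ ⊓ v ≤ M.box (pᶜ ⊓ v) := by
    rw [M.box_inf]
    exact le_inf ((inf_le_inf_left _ inf_le_right).trans inf_himp_le) (inf_le_right.trans hvo)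
  have hp : M.passive p = v \ (pᶜ ⊓ v) := by
    rw [sdiff_inf_self_right, sdiff_compl, hv, boxPlus, passive]
    have : p ≤ pᶜ ⇨ M.box pᶜ := by
      rw [himp_eq, compl_compl]
      exact le_sup_right
    rw [inf_assoc, inf_eq_right.2 this, inf_comm]
  rw [hp]
  exact BooleanSubalgebra.sdiff_mem (mem_openGenerated hvo) (mem_openGenerated hw)

/-- This is the Grz axiom at `pᶜ`, contraposed: whatever sees `p` sees its passive part. -/
theorem box_compl_passive_le (h : M.IsK4Grz) (p : M.carrier) :
    M.box (M.passive p)ᶜ ≤ M.box pᶜ := by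
  have h' := h.2 pᶜ
  rwa [himp_eq, sup_comm, ← compl_inf, inf_comm] at h'

theorem passive_ne_bot (h : M.IsK4Grz) {p : M.carrier} (hp : p ≠ ⊥) : M.passive p ≠ ⊥ := by
  intro h0
  have h1 := box_compl_passive_le h p
  rw [h0, compl_bot, M.box_top, top_le_iff] at h1
  rw [passive, h1, himp_top, M.box_top, inf_top_eq] at h0
  exact hp h0

theorem box_finset_inf {ι : Type*} (s : Finset ι) (f : ι → M.carrier) :
    M.box (s.inf f) = s.inf fun i => M.box (f i) := by
  classical
  induction s using Finset.induction_on with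
  | empty => simpa using M.box_top
  | insert i s _ ih => rw [Finset.inf_insert, Finset.inf_insert, M.box_inf, ih]

/-- Every finite part of a `K4.Grz`-algebra embeds into the subalgebra generated by the
quasi-open elements. -/
theorem exists_local_embedding (h : M.IsK4Grz) (S : Finset M.carrier) :
    ∃ g : M.carrier → M.carrier, (∀ a, g a ∈ M.openGenerated) ∧
      (∀ a ∈ S, ∀ b ∈ S, g a ≤ g b → a ≤ b) ∧
      (∀ a b, g (a ⊓ b) = g a ⊓ g b) ∧ (∀ a ∈ S, g aᶜ = (g a)ᶜ) ∧
      ∀ a ∈ S, g (M.box a) = M.box (g a) := by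
  classical
  obtain ⟨P, hP⟩ := exists_finpartition_decides (S ∪ (S.image M.box ∪ S.image M.boxPlus))
  have hPS {a : M.carrier} (ha : a ∈ S) : ∀ p ∈ P.parts, p ≤ a ∨ p ≤ aᶜ :=
    hP a (Finset.mem_union_left _ ha)
  obtain ⟨q, hdisj, hsup, hmem, hpq, hq⟩ := P.exists_enlargement M.openGenerated
    (S.image M.box ∪ S.image M.boxPlus)
    (fun e he => by
      rcases Finset.mem_union.1 he with he | he
      · obtain ⟨a, -, rfl⟩ := Finset.mem_image.1 he
        exact box_mem_openGenerated h.1 a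
      · obtain ⟨a, -, rfl⟩ := Finset.mem_image.1 he
        exact BooleanSubalgebra.subset_closure (boxPlus_boxPlus h.1 a))
    (fun e he => hP e (Finset.mem_union_right _ he)) M.passive
    (fun p _ => passive_mem_openGenerated h.1 p) (fun p _ => passive_le p)
  have hcompl {a : M.carrier} (ha : ∀ p ∈ P.parts, p ≤ a ∨ p ≤ aᶜ) :
      P.transfer q aᶜ = (P.transfer q a)ᶜ := Finpartition.transfer_compl hdisj hsup ha
  refine ⟨P.transfer q, fun a => Finpartition.transfer_mem hmem, fun a ha b hb =>
    Finpartition.le_of_transfer_le hdisj (fun p hp h0 => passive_ne_bot h (P.ne_bot hp)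
      (le_bot_iff.1 ((hpq p hp).trans h0.le))) (hPS ha) (hPS hb),
    fun a b => Finpartition.transfer_inf hdisj, fun a ha => hcompl (hPS ha), fun a ha => ?_⟩
  -- Each `q p` stays on the same side of `e` as `p`, and the `q p` cover `⊤`.
  have transfer_eq {e : M.carrier} (he : e ∈ S.image M.box ∪ S.image M.boxPlus) :
      P.transfer q e = e := by
    refine le_antisymm (Finpartition.transfer_le fun p hp => (hq e he p hp).1) ?_
    refine le_of_finset_sup_eq_top hsup fun p hp => ?_
    by_cases hpe : p ≤ e
    · exact inf_le_right.trans (Finpartition.le_transfer hp hpe)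
    · exact ((inf_le_inf_left e ((hq e he p hp).2 hpe)).trans inf_compl_eq_bot.le).trans bot_le
  have hbox : P.transfer q (M.box a) = M.box a :=
    transfer_eq (Finset.mem_union_left _ (Finset.mem_image_of_mem _ ha))
  have hplus : P.transfer q (M.boxPlus a) = M.boxPlus a :=
    transfer_eq (Finset.mem_union_right _ (Finset.mem_image_of_mem _ ha))
  rw [hbox]
  apply le_antisymm
  -- `a` may move under the transfer, but `□⁺a` is fixed and has the same box; this is why the
  -- partition must decide `□⁺a` as well.
  · rw [← box_boxPlus h.1 a, ← hplus]
    exact M.box_mono (Finpartition.transfer_le fun p hp hpa =>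
      Finpartition.le_transfer hp (hpa.trans inf_le_right))
  -- `a` is the meet of the complements of the cells outside it. For such a cell `p`, the image of
  -- `a` misses `q p`, hence the passive part of `p`.
  · have ha' : (P.parts.filter (· ≤ aᶜ)).inf compl ≤ a := by
      rw [← compl_le_compl_iff_le]
      refine le_of_finset_sup_eq_top P.sup_parts fun p hp => ?_
      rcases hPS ha p hp with hpa | hpa
      · exact ((inf_le_inf_left _ hpa).trans compl_inf_eq_bot.le).trans bot_le
      · exact inf_le_right.trans (le_compl_comm.1
          (Finset.inf_le (f := compl) (Finset.mem_filter.2 ⟨hp, hpa⟩)))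
    refine le_trans ?_ (M.box_mono ha')
    rw [box_finset_inf]
    refine Finset.le_inf fun p hp => ?_
    obtain ⟨hp, hpa⟩ := Finset.mem_filter.1 hp
    refine le_trans (M.box_mono ?_) (box_compl_passive_le h p)
    rw [← compl_le_compl_iff_le, compl_compl, ← hcompl (hPS ha)]
    exact (hpq p hp).trans (Finpartition.le_transfer hp hpa)

end ModalAlg
-- Embedding into an ultrapower of the skeleton, and the theorem.
namespace ModalAlg

/-- A `K4.Grz`-algebra belongs to the universal class generated by its subalgebra of quasi-open
generated elements. -/
theorem mem_of_skeleton_mem {M : ModalAlg.{u}} (h : M.IsK4Grz) {U : Set ModalAlg.{u}}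
    (hU : IsUniversalClass U) (hM : M.skeleton h.1 ∈ U) : M ∈ U := by
  classical
  choose g hg hle hinf hcompl hbox using fun S => exists_local_embedding h S
  -- Extending `atTop` makes every element of `M` belong to almost all finite sets, so local
  -- conditions on `S` become global in the ultrapower.
  let F : Ultrafilter (Finset M.carrier) := Ultrafilter.of Filter.atTop
  have hF (a : M.carrier) : ∀ᶠ S in (F : Filter (Finset M.carrier)), a ∈ S := by
    refine Ultrafilter.of_le Filter.atTop ?_
    filter_upwards [Filter.eventually_ge_atTop {a}] with S hS
    exact hS (Finset.mem_singleton_self a)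
  let N := ultraproduct F fun _ => M.skeleton h.1
  let φ (a : M.carrier) : N.carrier := Quotient.mk _ fun S => ⟨g S a, hg S a⟩
  have φ_inf (a b : M.carrier) : φ (a ⊓ b) = φ a ⊓ φ b :=
    Quotient.sound (Filter.Eventually.of_forall fun S => Subtype.ext (hinf S a b))
  have φ_compl (a : M.carrier) : φ aᶜ = (φ a)ᶜ :=
    Quotient.sound ((hF a).mono fun S hS => Subtype.ext (hcompl S a hS))
  have φ_box (a : M.carrier) : φ (M.box a) = N.box (φ a) :=
    Quotient.sound ((hF a).mono fun S hS => Subtype.ext (hbox S a hS))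
  have φ_le {a b : M.carrier} : φ a ≤ φ b ↔ a ≤ b := by
    constructor
    · intro hab
      have hab' : ∀ᶠ S in (F : Filter (Finset M.carrier)), g S a ≤ g S b := hab
      obtain ⟨S, ⟨h1, h2⟩, h3⟩ := ((hab'.and (hF a)).and (hF b)).exists
      exact hle S a h2 b h3 h1
    · intro hab
      rw [← inf_eq_left, ← φ_inf, inf_eq_left.2 hab]
  have φ_sup (a b : M.carrier) : φ (a ⊔ b) = φ a ⊔ φ b := by
    rw [← compl_inj_iff, ← φ_compl, compl_sup, φ_inf, φ_compl, φ_compl, compl_sup]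
  have φ_bot : φ ⊥ = ⊥ := by
    rw [← inf_compl_eq_bot (a := (⊥ : M.carrier)), φ_inf, φ_compl, inf_compl_eq_bot]
  let R : BooleanSubalgebra N.carrier :=
    { carrier := Set.range φ
      supClosed' := by
        rintro _ ⟨a, rfl⟩ _ ⟨b, rfl⟩
        exact ⟨a ⊔ b, φ_sup a b⟩
      infClosed' := by
        rintro _ ⟨a, rfl⟩ _ ⟨b, rfl⟩
        exact ⟨a ⊓ b, φ_inf a b⟩
      compl_mem' := by
        rintro _ ⟨a, rfl⟩
        exact ⟨aᶜ, φ_compl a⟩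
      bot_mem' := ⟨⊥, φ_bot⟩ }
  have hR : ∀ x ∈ R, N.box x ∈ R := by
    rintro _ ⟨a, rfl⟩
    exact ⟨M.box a, φ_box a⟩
  refine hU.iso_mem (hU.sub_mem (hU.ultraproduct_mem F _ fun _ => hM) R hR) (Iso.symm ?_)
  let ψ : M.carrier ↪o N.carrier := OrderEmbedding.ofMapLEIff φ fun _ _ => φ_le
  exact ⟨ψ.orderIso, fun a => Subtype.ext (φ_box a)⟩

theorem Uni_subset {K U : Set ModalAlg.{u}} (hU : IsUniversalClass U) (h : K ⊆ U) : Uni K ⊆ U :=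
  Set.sInter_subset_of_mem ⟨hU, h⟩

theorem subset_Uni (K : Set ModalAlg.{u}) : K ⊆ Uni K :=
  Set.subset_sInter fun _ h => h.2

end ModalAlg

theorem mainTheorem4 (U : Set ModalAlg.{u}) (hU : ModalAlg.IsUniversalClass U)
    (hGrz : ∀ M ∈ U, M.IsK4Grz) :
    U = ModalAlg.Uni {M | M ∈ U ∧ M.IsSkeletal} ∧ U = sigmaClass (rhoClass U) := by
  have hsk {M : ModalAlg.{u}} (hM : M ∈ U) (h : M.IsK4) : M.skeleton h ∈ U :=
    hU.sub_mem hM _ _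
  refine ⟨Set.Subset.antisymm (fun M hM => ?_) (ModalAlg.Uni_subset hU fun M hM => hM.1),
    Set.Subset.antisymm (fun M hM => ?_) (ModalAlg.Uni_subset hU ?_)⟩
  · exact ModalAlg.mem_of_skeleton_mem (hGrz M hM) (ModalAlg.isUniversalClass_Uni _)
      (ModalAlg.subset_Uni _ ⟨hsk hM _, ModalAlg.isSkeletal_skeleton _⟩)
  · exact ModalAlg.mem_of_skeleton_mem (hGrz M hM) (ModalAlg.isUniversalClass_Uni _)
      ((ModalAlg.isUniversalClass_Uni _).iso_mem
        (ModalAlg.subset_Uni _ ⟨M.rho (hGrz M hM).1, ⟨M, hM, _, rfl⟩, rfl⟩)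
        (ModalAlg.skeleton_iso_sigma_rho _).symm)
  · rintro _ ⟨_, ⟨M, hM, h, rfl⟩, rfl⟩
    exact hU.iso_mem (hsk hM h) (ModalAlg.skeleton_iso_sigma_rho h)
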